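/- Let $k,l$ be positive integers with $l<k$, let $d=\gcd(l,k)$ and $n=k/d$ (so $n>1$), let $c\in\mathrm{GF}(2^d)\subseteq\mathrm{GF}(2^k)$, and for $a\in\mathrm{GF}(2^k)$ put \[F_a(x)=a^{2^l}x^{2^{2l}}+x^{2^l}+ax+c .\] For $e\mid k$ let $\mathrm{Tr}_e^k(x)=\sum_{i=0}^{k/e-1}x^{2^{ie}}$ and $\mathrm{Tr}_k=\mathrm{Tr}_1^k$. Define polynomials over $\mathrm{GF}(2^k)$ by $C_1(x)=C_2(x)=1$, $C_{i+2}(x)=C_{i+1}(x)+x^{2^{il}}C_i(x)$ for $i\ge 1$, and $Z_n(x)=C_{n+1}(x)+x\,C_{n-1}(x)^{2^l}$. Let $N_i$ be the set of all $a\in\mathrm{GF}(2^k)^*$ such that $F_a$ has exactly $i$ distinct zeros in $\mathrm{GF}(2^k)$. Take any $a\in\mathrm{GF}(2^k)^*$. Then $F_a$ has exactly $2^d$ distinct zeros in $\mathrm{GF}(2^k)$ if and only if $Z_n(a)=0$ and $C_n(a)\neq 0$. In this case: (1) $\mathrm{Tr}_d^k(v)=(n-1)c$ for every zero $v\in\mathrm{GF}(2^k)$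 of $F_a$. (2) If $n$ is even and $c\neq 0$, then $\mathrm{Tr}_k\left(ac^{-2}v^{2^l+1}\right)$ has the same value for all zeros $v\in\mathrm{GF}(2^k)$ of $F_a$. (3) If $n$ is odd, then the zeros of $F_a$ in $\mathrm{GF}(2^k)$ are exactly the elements \[v_\mu=c\sum_{i=0}^{\frac{n-1}{2}}\frac{C_{n-1}(a)^{2^{(2i+1)l}}}{C_n(a)^{2^{(2i+1)l}+2^{2il}-1}}+\mu\, C_n(a),\qquad \mu\in\mathrm{GF}(2^d),\] and, if moreover $c\neq 0$, then \[\sum_{\mu\in\mathrm{GF}(2^d)}(-1)^{\mathrm{Tr}_k\left(ac^{-2}v_\mu^{2^l+1}\right)}=0 .\] Finally, $|N_{2^d}|=2^{k-d}-1$ if $n$ is odd, and $|N_{2^d}|=2^{k-d}$ if $n$ is even. -/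

import Mathlib

namespace AffinePoly

open Polynomial

/-- The map `Tr_d^k(x) = ∑_{i=0}^{k/d-1} x^{2^{id}}` (for `d ∣ k`, on a field with `2^k` elements,
the trace onto its subfield with `2^d` elements). `Tr_k` is the case `d = 1`. -/
def tr {K : Type*} [Field K] (d k : ℕ) (x : K) : K :=
  ∑ i ∈ Finset.range (k / d), x ^ 2 ^ (i * d)

open Classical in
/-- The sign `(-1)^t` of an element `t ∈ GF(2) = {0, 1}` of `K`; only used at values of `Tr_k`. -/
noncomputable def sign {K : Type*} [Field K] (t : K) : ℤ :=
  if t = 0 then 1 else -1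

/-- The polynomials `C_1 = C_2 = 1`, `C_{i+2} = C_{i+1} + x^{2^{il}} C_i` for `i ≥ 1`
(the value at index `0` is never used). -/
noncomputable def polyC (K : Type*) [Field K] (l : ℕ) : ℕ → K[X]
  | 0 => 0
  | 1 => 1
  | 2 => 1
  | (i + 3) => polyC K l (i + 2) + X ^ 2 ^ ((i + 1) * l) * polyC K l (i + 1)

/-- The polynomials `Z_1 = 1` and `Z_n = C_{n+1} + x C_{n-1}^{2^l}` for `n > 1`. -/
noncomputable def polyZ (K : Type*) [Field K] (l n : ℕ) : K[X] :=
  if n = 1 then 1 else polyC K l (n + 1) + X * polyC K l (n - 1) ^ 2 ^ l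

/-- The affine polynomial `F_a(x) = a^{2^l} x^{2^{2l}} + x^{2^l} + a x + c`. -/
noncomputable def polyF {K : Type*} [Field K] (l : ℕ) (c a : K) : K[X] :=
  C (a ^ 2 ^ l) * X ^ 2 ^ (2 * l) + X ^ 2 ^ l + C a * X + C c

/-- The set of zeros of `F_a` in `K`. -/
def zerosF {K : Type*} [Field K] (l : ℕ) (c a : K) : Set K :=
  {v | (polyF l c a).eval v = 0}

/-- `N_i`: the nonzero `a` for which `F_a` has exactly `i` (distinct) zeros in `K`. -/
def setN {K : Type*} [Field K] (l : ℕ) (c : K) (i : ℕ) : Set K :=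
  {a | a ≠ 0 ∧ (zerosF l c a).ncard = i}

/-- `v_μ = c ∑_{i=0}^{(n-1)/2} C_{n-1}(a)^{2^{(2i+1)l}} / C_n(a)^{2^{(2i+1)l} + 2^{2il} - 1}
+ μ C_n(a)`, for odd `n`. -/
noncomputable def explicitZero {K : Type*} [Field K] (l n : ℕ) (c a μ : K) : K :=
  c * ∑ i ∈ Finset.range ((n - 1) / 2 + 1),
      (polyC K l (n - 1)).eval a ^ 2 ^ ((2 * i + 1) * l) /
        (polyC K l n).eval a ^ (2 ^ ((2 * i + 1) * l) + 2 ^ (2 * i * l) - 1)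
    + μ * (polyC K l n).eval a

end AffinePoly

set_option linter.unusedSectionVars false

namespace AffinePoly

/-! ### Semilinear identities for the linear part and the continuants. -/

section Semilinear

variable {K : Type*} [Field K]

/-! Put σ = Frobenius^l. It satisfies σ^n = 1 with fixed field E = GF(2^d), and F_a = L + c with
L(x) = σ(a)σ²(x) + σ(x) + ax.

Let x be a nonzero zero of L and g = axσ(x). Then σ(x)L(xt) = h + σ(h) with h = g(σt + t), so zeros
of L are governed by Tr(1/g). By `contin_sq` at index n, C_n = νx with ν ∈ E and ν² =
Norm(a)Tr(1/g). Since Z_n(a) = L(C_n), this forces Z_n(a) = 0. If C_n vanished, then Tr(1/g) = 0,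
and additive Hilbert 90 would give a zero of L outside Ex, hence too many zeros of F_a.

Conversely, if Z_n(a) = 0 and C_n ≠ 0, take x = C_n, u = aσ(C_{n-1}), N = Norm(a). Then σu + u = σx,
u² + g = N and N Tr(1/g) = 1 (`resonant_contin`). Hence xt is a zero of F_a iff σt + t = cu/g,
solvable because Tr(u/g) = 0; the zeros form a coset of Ex. Traces of zeros and the quadratic form
follow from the same relations (`tr_zero`, `quad_shift`).

For the count, (a, λ) ↦ λg with λ ∈ E nonzero is a bijection onto the y ∉ E with Tr(1/y) ≠ 0
(`ncard_resonance_mul`). Inversion and Tr(e) = ne on E then explain the dependence on the parity of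
n. -/

theorem ringHom_pow_succ_apply (σ : K →+* K) (i : ℕ) (y : K) :
    (σ ^ (i + 1)) y = σ ((σ ^ i) y) := by
  rw [pow_succ']; rfl

theorem ringHom_pow_apply_comm (σ : K →+* K) (i : ℕ) (y : K) :
    (σ ^ i) (σ y) = σ ((σ ^ i) y) := by
  rw [← ringHom_pow_succ_apply, pow_succ]; rfl

/-- The continuants `C_0 = 0`, `C_1 = 1`, `C_{i+2} = C_{i+1} + σ^i(a) C_i`. -/
def contin (σ : K →+* K) (a : K) : ℕ → K
  | 0 => 0
  | 1 => 1
  | (i + 2) => contin σ a (i + 1) + (σ ^ i) a * contin σ a i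

theorem contin_add_two (σ : K →+* K) (a : K) (i : ℕ) :
    contin σ a (i + 2) = contin σ a (i + 1) + (σ ^ i) a * contin σ a i := rfl

/-- The linear part of `F_a`. -/
def linPart (σ : K →+* K) (a x : K) : K := σ a * σ (σ x) + σ x + a * x

/-- The sum of the first `n` conjugates under `σ`. -/
def trSum (σ : K →+* K) (n : ℕ) (y : K) : K := ∑ i ∈ Finset.range n, (σ ^ i) y

/-- The product of the first `n` conjugates under `σ`. -/
def normProd (σ : K →+* K) (n : ℕ) (y : K) : K := ∏ i ∈ Finset.range n, (σ ^ i) y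

theorem trSum_add (σ : K →+* K) (n : ℕ) (y z : K) :
    trSum σ n (y + z) = trSum σ n y + trSum σ n z := by
  simp [trSum, Finset.sum_add_distrib]

theorem ringHom_pow_fixed (σ : K →+* K) (i : ℕ) {e : K} (he : σ e = e) : (σ ^ i) e = e := by
  induction i with
  | zero => rfl
  | succ i ih => rw [ringHom_pow_succ_apply, ih, he]

theorem trSum_mul_fixed (σ : K →+* K) (n : ℕ) {e : K} (he : σ e = e) (y : K) :
    trSum σ n (e * y) = e * trSum σ n y := by
  simp [trSum, Finset.mul_sum, ringHom_pow_fixed σ _ he, -RingHom.coe_pow]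

theorem trSum_fixed (σ : K →+* K) (n : ℕ) {e : K} (he : σ e = e) :
    trSum σ n e = n * e := by
  simp [trSum, ringHom_pow_fixed σ _ he, -RingHom.coe_pow]

theorem map_trSum_comm (σ : K →+* K) (n : ℕ) (y : K) :
    σ (trSum σ n y) = trSum σ n (σ y) := by
  simp [trSum, map_sum, ringHom_pow_apply_comm]

theorem trSum_map {σ : K →+* K} {n : ℕ} (hσ : ∀ y, (σ ^ n) y = y) (y : K) :
    trSum σ n (σ y) = trSum σ n y := by
  have h1 := Finset.sum_range_succ (fun i => (σ ^ i) y) n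
  have h2 := Finset.sum_range_succ' (fun i => (σ ^ i) y) n
  rw [h1] at h2
  simp only [hσ, ringHom_pow_succ_apply, pow_zero, RingHom.one_def, RingHom.id_apply] at h2
  simp only [trSum, ringHom_pow_apply_comm]
  exact (add_right_cancel h2).symm

theorem map_trSum {σ : K →+* K} {n : ℕ} (hσ : ∀ y, (σ ^ n) y = y) (y : K) :
    σ (trSum σ n y) = trSum σ n y := by
  rw [map_trSum_comm, trSum_map hσ]

theorem map_normProd {σ : K →+* K} {n : ℕ} (hσ : ∀ y, (σ ^ n) y = y) {y : K} (hy : y ≠ 0) :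
    σ (normProd σ n y) = normProd σ n y := by
  have h1 := Finset.prod_range_succ (fun i => (σ ^ i) y) n
  have h2 := Finset.prod_range_succ' (fun i => (σ ^ i) y) n
  rw [h1] at h2
  simp only [hσ, ringHom_pow_succ_apply, pow_zero, RingHom.one_def, RingHom.id_apply] at h2
  simp only [normProd, map_prod]
  exact (mul_right_cancel₀ hy h2).symm

theorem normProd_ne_zero (σ : K →+* K) (n : ℕ) {y : K} (hy : y ≠ 0) : normProd σ n y ≠ 0 := by
  simp [normProd, Finset.prod_ne_zero_iff, hy, -RingHom.coe_pow]

theorem linPart_add (σ : K →+* K) (a x y : K) :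
    linPart σ a (x + y) = linPart σ a x + linPart σ a y := by
  simp only [linPart, map_add]; ring

theorem linPart_fixed_mul (σ : K →+* K) (a x : K) {e : K} (he : σ e = e) :
    linPart σ a (e * x) = e * linPart σ a x := by
  simp only [linPart, map_mul, he]; ring

variable [CharP K 2]

theorem trSum_sq (σ : K →+* K) (n : ℕ) (y : K) : trSum σ n (y ^ 2) = trSum σ n y ^ 2 := by
  simp only [trSum, map_pow]
  exact (sum_pow_char 2 _ _).symm

/-- A continuant may be expanded from its first entry as well as from its last; this brings in the
conjugates of earlier continuants that `linPart` sees. -/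
theorem contin_reverse (σ : K →+* K) (a : K) : ∀ i, contin σ a (i + 2) =
    σ (contin σ a (i + 1)) + σ a * σ (σ (contin σ a i))
  | 0 => by simp [contin]
  | 1 => by simp [contin]
  | (i + 2) => by
    have h1 := contin_reverse σ a (i + 1)
    have h0 := contin_reverse σ a i
    have e1 := congrArg σ (contin_add_two σ a (i + 1))
    have e0 := congrArg (fun y => σ (σ y)) (contin_add_two σ a i)
    simp only [map_add, map_mul, ← ringHom_pow_succ_apply] at e1 e0
    rw [contin_add_two σ a (i + 2)]
    linear_combination h1 + (σ ^ (i + 2)) a * h0 - e1 - σ a * e0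

/-- A Casoratian: the sequences C_{i+1} and σ(C_i) satisfy the same second-order recurrence, so each
step multiplies their determinant by the next conjugate of a. Signs disappear in characteristic 2.
-/
theorem contin_det (σ : K →+* K) (a : K) (i : ℕ) :
    a * (σ (contin σ a i) * contin σ a (i + 2) + contin σ a (i + 1) * σ (contin σ a (i + 1))) =
      normProd σ (i + 1) a := by
  induction i with
  | zero => simp [contin, normProd]
  | succ i ih =>
    rw [normProd, Finset.prod_range_succ, ← normProd, ← ih]
    have h : σ (contin σ a (i + 1 + 1)) = σ (contin σ a (i + 1) + (σ ^ i) a * contin σ a i) := rfl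
    rw [contin_add_two σ a (i + 1), h]
    simp only [map_add, map_mul, ringHom_pow_succ_apply]
    have : (2 : K) = 0 := CharTwo.two_eq_zero
    linear_combination (a * contin σ a (i + 2) * σ (contin σ a (i + 1))) * this

/-- The right side is Z_n(a) for n = m + 2. Expanding σ²(C_n) from its last entry produces σ^n(a),
which wraps around to a. -/
theorem linPart_contin {σ : K →+* K} {a : K} {m : ℕ} (hσ : (σ ^ (m + 2)) a = a) :
    linPart σ a (contin σ a (m + 2)) =
      contin σ a (m + 3) + a * σ (contin σ a (m + 1)) := by
  have h2 : σ (σ (contin σ a (m + 2))) =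
      σ (σ (contin σ a (m + 1))) + a * σ (σ (contin σ a m)) := by
    rw [contin]; simp only [map_add, map_mul]
    rw [← ringHom_pow_succ_apply, ← ringHom_pow_succ_apply, hσ]
  have h3 := contin_reverse σ a m
  have h4 := contin_reverse σ a (m + 1)
  have : (2 : K) = 0 := CharTwo.two_eq_zero
  rw [linPart, h2, h4]
  linear_combination a * h3 + a * σ a * σ (σ (contin σ a m)) * this

/-- Reduction of order: a known zero x turns the second-order operator into two successive
first-order ones in t. -/
theorem linPart_mul {σ : K →+* K} {a x : K} (hx : linPart σ a x = 0) (t : K) :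
    σ x * linPart σ a (x * t) =
      a * x * σ x * (σ t + t) + σ (a * x * σ x * (σ t + t)) := by
  have : (2 : K) = 0 := CharTwo.two_eq_zero
  simp only [linPart, map_mul, map_add] at *
  linear_combination (σ x * σ t) * hx -
    (σ x * σ t * a * x + σ a * σ x * σ (σ x) * σ t) * this

theorem linPart_eq_zero_iff {σ : K →+* K} {a x : K} (hx : x ≠ 0) :
    linPart σ a x = 0 ↔ σ (a * x * σ x) + a * x * σ x = σ x ^ 2 := by
  have : (2 : K) = 0 := CharTwo.two_eq_zero
  have hx' : σ x ≠ 0 := by simpa using hx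
  simp only [linPart, map_mul]
  constructor
  · intro h
    linear_combination σ x * h - σ x ^ 2 * this
  · intro h
    apply mul_left_cancel₀ hx'
    linear_combination h + σ x ^ 2 * this

/-- Squaring the recurrence is additive in characteristic 2, so the squares obey a linear
recurrence; the right side satisfies it because conjugates of x are zeros of the conjugated
operators. -/
theorem contin_sq {σ : K →+* K} {a x : K} (ha : a ≠ 0) (hx0 : x ≠ 0) (hx : linPart σ a x = 0) :
    ∀ i, contin σ a i ^ 2 =
      normProd σ i a * (σ ^ i) x * x * trSum σ i (a * x * σ x)⁻¹
  | 0 => by simp [contin, trSum]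
  | 1 => by
    have hx' : σ x ≠ 0 := by simpa using hx0
    simp [contin, trSum, normProd]
    field_simp
  | (i + 2) => by
    have h2 : (2 : K) = 0 := CharTwo.two_eq_zero
    have h1 := contin_sq ha hx0 hx (i + 1)
    have h0 := contin_sq ha hx0 hx i
    have hL : σ ((σ ^ i) a) * σ (σ ((σ ^ i) x)) + σ ((σ ^ i) x) + (σ ^ i) a * (σ ^ i) x = 0 := by
      have := congrArg (σ ^ i) hx
      simpa [linPart, ringHom_pow_apply_comm, -RingHom.coe_pow] using this
    have e : contin σ a (i + 2) ^ 2 =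
        contin σ a (i + 1) ^ 2 + ((σ ^ i) a) ^ 2 * contin σ a i ^ 2 := by
      rw [contin]; linear_combination contin σ a (i + 1) * (σ ^ i) a * contin σ a i * h2
    rw [e, h1, h0]
    simp only [trSum, normProd, Finset.sum_range_succ, Finset.prod_range_succ,
      ringHom_pow_succ_apply, map_inv₀, map_mul, ringHom_pow_apply_comm]
    have n1 : (σ ^ i) a ≠ 0 := (map_ne_zero _).2 ha
    have n2 : (σ ^ i) x ≠ 0 := (map_ne_zero _).2 hx0
    generalize (∏ j ∈ Finset.range i, (σ ^ j) a) = A at *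
    generalize (∑ j ∈ Finset.range i, _ : K) = S at *
    have n3 : σ ((σ ^ i) a) ≠ 0 := by simpa using n1
    have n4 : σ ((σ ^ i) x) ≠ 0 := by simpa using n2
    have n5 : σ (σ ((σ ^ i) x)) ≠ 0 := by simpa using n4
    generalize (σ ^ i) a = a0 at *
    generalize (σ ^ i) x = x0 at *
    generalize σ a0 = a1 at *
    generalize σ (σ x0) = x2 at *
    generalize σ x0 = x1 at *
    field_simp
    linear_combination (-A * (a0 * x1 * S * x0 + 1)) * hL +
      A * (x1 * (a0 * x1 * S * x0) + x1 + x0 * a0 * (a0 * x1 * S * x0)) * h2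

end Semilinear

/-! ### Consequences of Z_n(a) = 0 and C_n(a) ≠ 0. -/

section Resonant

variable {K : Type*} [Field K] [CharP K 2]

theorem fixed_of_sq_fixed {σ : K →+* K} {y : K} (h : σ (y ^ 2) = y ^ 2) : σ y = y := by
  rw [map_pow] at h
  exact frobenius_inj K 2 (by simpa [frobenius_def] using h)

theorem map_eq_iff_add {σ : K →+* K} {y : K} : σ y = y ↔ y + σ y = 0 := by
  rw [CharTwo.add_eq_zero, eq_comm]

theorem map_normProd_mul_trSum {σ : K →+* K} {n : ℕ} (hσ : ∀ y, (σ ^ n) y = y) {a : K} (ha : a ≠ 0)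
    (y : K) : σ (normProd σ n a * trSum σ n y) = normProd σ n a * trSum σ n y := by
  rw [map_mul, map_normProd hσ ha, map_trSum hσ]

/-- If the linear part has a nonzero zero `x`, then `C_n(a)` is a fixed multiple of `x`. -/
theorem contin_eq_fixed_mul {σ : K →+* K} {n : ℕ} (hσ : ∀ y, (σ ^ n) y = y) {a x : K}
    (ha : a ≠ 0) (hx0 : x ≠ 0) (hx : linPart σ a x = 0) :
    ∃ ν, σ ν = ν ∧ contin σ a n = ν * x ∧
      ν ^ 2 = normProd σ n a * trSum σ n (a * x * σ x)⁻¹ := by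
  have h := contin_sq ha hx0 hx n
  rw [hσ] at h
  have hsq : (contin σ a n / x) ^ 2 = normProd σ n a * trSum σ n (a * x * σ x)⁻¹ := by
    rw [div_pow, h]; field_simp
  refine ⟨contin σ a n / x, fixed_of_sq_fixed ?_, ?_, hsq⟩
  · rw [hsq, map_normProd_mul_trSum hσ ha]
  · field_simp

theorem polyZ_contin_eq_zero {σ : K →+* K} {m : ℕ} (hσ : ∀ y, (σ ^ (m + 2)) y = y) {a x : K}
    (ha : a ≠ 0) (hx0 : x ≠ 0) (hx : linPart σ a x = 0) :
    contin σ a (m + 3) + a * σ (contin σ a (m + 1)) = 0 := by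
  obtain ⟨ν, hν, h, -⟩ := contin_eq_fixed_mul hσ ha hx0 hx
  rw [← linPart_contin (hσ a), h, linPart_fixed_mul σ a x hν, hx, mul_zero]

/-- The data attached to a parameter `a` with `Z_n(a) = 0` and `C_n(a) ≠ 0`. -/
structure Resonant (σ : K →+* K) (n : ℕ) (a x u g N : K) : Prop where
  iter : ∀ y, (σ ^ n) y = y
  a_ne : a ≠ 0
  x_ne : x ≠ 0
  g_eq : g = a * x * σ x
  N_eq : N = normProd σ n a
  lin : linPart σ a x = 0
  map_u : σ u + u = σ x
  u_sq : u ^ 2 + g = N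
  tr_inv : N * trSum σ n g⁻¹ = 1

theorem resonant_contin {σ : K →+* K} {m : ℕ} (hσ : ∀ y, (σ ^ (m + 2)) y = y) {a : K}
    (ha : a ≠ 0) (hx0 : contin σ a (m + 2) ≠ 0)
    (hZ : contin σ a (m + 3) + a * σ (contin σ a (m + 1)) = 0) :
    Resonant σ (m + 2) a (contin σ a (m + 2)) (a * σ (contin σ a (m + 1)))
      (a * contin σ a (m + 2) * σ (contin σ a (m + 2))) (normProd σ (m + 2) a) := by
  have h2 : (2 : K) = 0 := CharTwo.two_eq_zero
  have hl : linPart σ a (contin σ a (m + 2)) = 0 := by rw [linPart_contin (hσ a), hZ]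
  refine ⟨hσ, ha, hx0, rfl, rfl, hl, ?_, ?_, ?_⟩
  · have h := contin_reverse σ a (m + 1)
    rw [map_mul]
    linear_combination hZ - h - σ (contin σ a (m + 1 + 1)) * h2
  · rw [← contin_det σ a (m + 1)]
    linear_combination (- a * σ (contin σ a (m + 1))) * hZ +
      a ^ 2 * σ (contin σ a (m + 1)) ^ 2 * h2
  · obtain ⟨ν, -, h, h'⟩ := contin_eq_fixed_mul hσ ha hx0 hl
    rw [← h', mul_right_cancel₀ hx0 ((one_mul _).trans h).symm, one_pow]

namespace Resonant

variable {σ : K →+* K} {n : ℕ} {a x u g N : K} (R : Resonant σ n a x u g N)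
include R

theorem map_x_ne : σ x ≠ 0 := (map_ne_zero σ).2 R.x_ne

theorem g_ne : g ≠ 0 := by
  rw [R.g_eq]; exact mul_ne_zero (mul_ne_zero R.a_ne R.x_ne) R.map_x_ne

theorem N_ne : N ≠ 0 := by rw [R.N_eq]; exact normProd_ne_zero σ n R.a_ne

theorem map_N : σ N = N := by rw [R.N_eq]; exact map_normProd R.iter R.a_ne

theorem tr_inv_g : trSum σ n g⁻¹ = N⁻¹ := eq_inv_of_mul_eq_one_right R.tr_inv

theorem tr_u_sq_div : trSum σ n (u ^ 2 * g⁻¹) = n + 1 := by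
  have h2 : (2 : K) = 0 := CharTwo.two_eq_zero
  have : u ^ 2 * g⁻¹ = N * g⁻¹ + 1 := by
    have := R.g_ne
    field_simp
    linear_combination R.u_sq - g * h2
  rw [this, trSum_add, trSum_mul_fixed σ n R.map_N, R.tr_inv, trSum_fixed σ n (map_one σ)]
  ring

/-- Since u² = N + g, squaring u/g gives N/g² + 1/g, whose trace is N·N⁻² + N⁻¹ = 0. This is the
solvability condition for `σ t + t = c * (u * g⁻¹)`. -/
theorem tr_u_div : trSum σ n (u * g⁻¹) = 0 := by
  have h2 : (2 : K) = 0 := CharTwo.two_eq_zero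
  have hN := R.N_ne
  have : (u * g⁻¹) ^ 2 = N * g⁻¹ ^ 2 + g⁻¹ := by
    have := R.g_ne
    field_simp
    linear_combination R.u_sq - g * h2
  have h := congrArg (trSum σ n) this
  rw [trSum_sq, trSum_add, trSum_mul_fixed σ n R.map_N, trSum_sq, R.tr_inv_g] at h
  have : trSum σ n (u * g⁻¹) ^ 2 = 0 := by
    rw [h]; field_simp; linear_combination h2
  exact pow_eq_zero_iff two_ne_zero |>.1 this

theorem linPart_mul_add_eq_zero_iff {c : K} (hc : σ c = c) (t : K) :
    linPart σ a (x * t) + c = 0 ↔ σ t + t = c * (u * g⁻¹) := by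
  have h2 : (2 : K) = 0 := CharTwo.two_eq_zero
  have hg := R.g_ne
  have key : σ x * (linPart σ a (x * t) + c) =
      (g * (σ t + t) + c * u) + σ (g * (σ t + t) + c * u) := by
    rw [mul_add, linPart_mul R.lin, ← R.g_eq, map_add σ (g * (σ t + t)), map_mul σ c, hc,
      ← R.map_u]
    ring
  constructor
  · intro h
    rw [h, mul_zero] at key
    have hfix := map_eq_iff_add.2 key.symm
    -- Here `e` is fixed by σ. Taking traces of `hs` leaves 0 = e/N, so `e` vanishes.
    set e := g * (σ t + t) + c * u with he
    have hs : σ t + t = c * (u * g⁻¹) + e * g⁻¹ := by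
      rw [he]; field_simp; linear_combination - u * c * h2
    have hT := congrArg (trSum σ n) hs
    rw [trSum_add, trSum_add, trSum_map R.iter, trSum_mul_fixed σ n hc, R.tr_u_div,
      trSum_mul_fixed σ n hfix, R.tr_inv_g, CharTwo.add_self_eq_zero, mul_zero, zero_add] at hT
    have : e = 0 := by
      rcases mul_eq_zero.1 hT.symm with h | h
      · exact h
      · exact absurd h (inv_ne_zero R.N_ne)
    rw [hs, this]; ring
  · intro h
    have : g * (σ t + t) + c * u = 0 := by
      rw [h]; field_simp; linear_combination u * c * h2
    rw [this, map_zero, add_zero] at key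
    exact (mul_eq_zero.1 key).resolve_left R.map_x_ne

/-- Summation by parts: Tr(xt) = Tr((σu + u)σt) = Tr(u(σt + t)) = c Tr(u²/g). -/
theorem tr_zero {c : K} (hc : σ c = c) {t : K} (ht : σ t + t = c * (u * g⁻¹)) :
    trSum σ n (x * t) = c * (n + 1) := by
  rw [← trSum_map R.iter, map_mul, ← R.map_u]
  have : (σ u + u) * σ t = σ (u * t) + u * σ t := by rw [map_mul]; ring
  rw [this, trSum_add, trSum_map R.iter, ← trSum_add, ← R.tr_u_sq_div, ← trSum_mul_fixed σ n hc]
  congr 1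
  linear_combination u * ht

theorem zeros_eq_range {E : Subfield K} (hE : ∀ y, y ∈ E ↔ σ y = y) {c : K} (hc : σ c = c) {t : K}
    (ht : σ t + t = c * (u * g⁻¹)) :
    {v | linPart σ a v + c = 0} = Set.range (fun μ : E => x * t + (μ : K) * x) := by
  have hx := R.x_ne
  have h2 : (2 : K) = 0 := CharTwo.two_eq_zero
  ext v
  simp only [Set.mem_ofPred_eq, Set.mem_range]
  constructor
  · intro h
    have hv : v = x * (v / x) := by field_simp
    rw [hv, R.linPart_mul_add_eq_zero_iff hc] at h
    refine ⟨⟨v / x + t, ?_⟩, ?_⟩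
    · rw [hE, map_add]
      linear_combination h - ht - v / x * h2 + σ t * h2
    · simp only
      field_simp
      linear_combination x * t * h2
  · rintro ⟨μ, rfl⟩
    have hμ := (hE _).1 μ.2
    have : x * t + (μ : K) * x = x * (t + μ) := by ring
    rw [this, R.linPart_mul_add_eq_zero_iff hc, map_add, hμ]
    linear_combination ht + (μ : K) * h2

/-- Along the zeros, the quadratic form changes by `w + w ^ 2` (which has absolute trace zero)
plus an element of the fixed field. -/
theorem quad_shift {c : K} (hc : c ≠ 0) {t : K} (ht : σ t + t = c * (u * g⁻¹)) {μ : K}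
    (hμ : σ μ = μ) :
    a * (c ^ 2)⁻¹ * ((x * t + μ * x) * σ (x * t + μ * x)) =
      a * (c ^ 2)⁻¹ * (x * t * σ (x * t)) + (μ * c⁻¹ * u + (μ * c⁻¹ * u) ^ 2) +
        (μ * c⁻¹) ^ 2 * N := by
  have h2 : (2 : K) = 0 := CharTwo.two_eq_zero
  have hg := R.g_ne
  have h : g * (σ t + t) = c * u := by rw [ht]; field_simp
  have hN := R.u_sq
  have hgd := R.g_eq
  simp only [map_add, map_mul, hμ]
  field_simp
  linear_combination μ * h - (μ * (σ t + t) + μ ^ 2) * hgd + μ ^ 2 * hN - μ ^ 2 * u ^ 2 * h2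

end Resonant

end Resonant

/-! ### Zero counts and the number of resonant parameters. -/

section Count

variable {K : Type*} [Field K] [CharP K 2]

theorem ncard_range_add_mul {K : Type*} [Field K] (E : Subfield K) {x : K} (hx : x ≠ 0) (v : K) :
    (Set.range (fun μ : E => v + (μ : K) * x)).ncard = Nat.card E := by
  rw [← Set.image_univ, Set.ncard_image_of_injective, Set.ncard_univ]
  intro μ ν h
  exact Subtype.ext (mul_right_cancel₀ hx (add_left_cancel h))

variable [Finite K] {σ : K →+* K} {m : ℕ} {E : Subfield K}

/-- If `F_a` has as many zeros as the fixed field has elements, then `Z_n(a) = 0`, `C_n(a) ≠ 0`. -/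
theorem resonance_of_ncard_zeros (hσ : ∀ y, (σ ^ (m + 2)) y = y) (hE : ∀ y, y ∈ E ↔ σ y = y)
    (h90 : ∀ y, trSum σ (m + 2) y = 0 → ∃ t, σ t + t = y) {a c : K} (ha : a ≠ 0)
    (hcard : {v | linPart σ a v + c = 0}.ncard = Nat.card E) :
    contin σ a (m + 3) + a * σ (contin σ a (m + 1)) = 0 ∧ contin σ a (m + 2) ≠ 0 := by
  have hE1 : 1 < {v | linPart σ a v + c = 0}.ncard := hcard ▸ Finite.one_lt_card
  obtain ⟨v, w, hv, hw, hvw⟩ := (Set.one_lt_ncard_iff (Set.toFinite _)).1 hE1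
  have hv' : linPart σ a v + c = 0 := hv
  have hw' : linPart σ a w + c = 0 := hw
  have hx0 : v + w ≠ 0 := fun h => hvw (CharTwo.add_eq_zero.1 h)
  have hx : linPart σ a (v + w) = 0 := by
    have h2 : (2 : K) = 0 := CharTwo.two_eq_zero
    rw [linPart_add]
    linear_combination hv' + hw' - c * h2
  refine ⟨polyZ_contin_eq_zero hσ ha hx0 hx, fun hC => ?_⟩
  set x := v + w
  have hsx : σ x ≠ 0 := (map_ne_zero σ).2 hx0
  obtain ⟨ν, -, hν, hν2⟩ := contin_eq_fixed_mul hσ ha hx0 hx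
  have hν0 : ν = 0 := by
    rw [hC] at hν
    exact (mul_eq_zero.1 hν.symm).resolve_right hx0
  have hT : trSum σ (m + 2) (a * x * σ x)⁻¹ = 0 := by
    rw [hν0, zero_pow two_ne_zero] at hν2
    exact (mul_eq_zero.1 hν2.symm).resolve_left (normProd_ne_zero σ _ ha)
  -- With σt + t = 1/g, the quantity g(σt + t) is 1, hence fixed, so xt is again a zero of the
  -- linear part. It lies outside Ex because `t` is not fixed, giving more than |E| zeros of F_a.
  obtain ⟨t, ht⟩ := h90 _ hT
  have hxt : linPart σ a (x * t) = 0 := by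
    have h := linPart_mul hx t
    have hg : a * x * σ x ≠ 0 := mul_ne_zero (mul_ne_zero ha hx0) hsx
    rw [ht, mul_inv_cancel₀ hg, map_one, CharTwo.add_self_eq_zero] at h
    exact (mul_eq_zero.1 h).resolve_left hsx
  have hsub : insert (v + x * t) (Set.range (fun μ : E => v + (μ : K) * x)) ⊆
      {v | linPart σ a v + c = 0} := by
    rintro y (rfl | ⟨μ, rfl⟩)
    · change linPart σ a (v + x * t) + c = 0
      rw [linPart_add, hxt, add_zero, hv']
    · change linPart σ a (v + μ * x) + c = 0
      rw [linPart_add, linPart_fixed_mul σ a x ((hE _).1 μ.2), hx, mul_zero, add_zero, hv']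
  have hnot : v + x * t ∉ Set.range (fun μ : E => v + (μ : K) * x) := by
    rintro ⟨μ, h⟩
    have h1 : (μ : K) = t := by
      apply mul_right_cancel₀ hx0
      rw [mul_comm t]
      exact add_left_cancel h
    rw [← h1, (hE _).1 μ.2, CharTwo.add_self_eq_zero] at ht
    exact inv_ne_zero (mul_ne_zero (mul_ne_zero ha hx0) hsx) ht.symm
  have := Set.ncard_le_ncard hsub (Set.toFinite _)
  rw [Set.ncard_insert_of_notMem hnot (Set.toFinite _), ncard_range_add_mul E hx0, hcard] at this
  omega

/-- The resonant parameters, paired with the nonzero fixed elements, are parametrized by the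
non-fixed elements whose inverse has nonzero trace. -/
theorem ncard_resonance_mul (hσ : ∀ y, (σ ^ (m + 2)) y = y) (hE : ∀ y, y ∈ E ↔ σ y = y) :
    {a | a ≠ 0 ∧ contin σ a (m + 3) + a * σ (contin σ a (m + 1)) = 0 ∧
        contin σ a (m + 2) ≠ 0}.ncard * ((E : Set K) \ {0}).ncard =
      {y | y ∉ E ∧ trSum σ (m + 2) y⁻¹ ≠ 0}.ncard := by
  have h2 : (2 : K) = 0 := CharTwo.two_eq_zero
  rw [← Set.ncard_prod]
  -- The image λg determines λσ(x)², where x = C_n(a). Equal images thus make the ratio of the two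
  -- continuants a fixed element, which is what injectivity needs.
  have hpos : ∀ a l : K, a ≠ 0 → l ≠ 0 → σ l = l → contin σ a (m + 2) ≠ 0 →
      contin σ a (m + 3) + a * σ (contin σ a (m + 1)) = 0 →
      σ (l * (a * contin σ a (m + 2) * σ (contin σ a (m + 2)))) +
        l * (a * contin σ a (m + 2) * σ (contin σ a (m + 2))) =
          l * σ (contin σ a (m + 2)) ^ 2 := by
    intro a l ha hl hlE hC hZ
    have R := resonant_contin hσ ha hC hZ
    rw [map_mul σ l, hlE, ← mul_add, (linPart_eq_zero_iff hC).1 R.lin]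
  refine Set.ncard_congr (fun p _ => p.2 * (p.1 * contin σ p.1 (m + 2) *
    σ (contin σ p.1 (m + 2)))) ?_ ?_ ?_
  · rintro ⟨a, l⟩ ⟨⟨ha, hZ, hC⟩, hlE, hl⟩
    replace hlE : σ l = l := (hE l).1 hlE
    replace hl : l ≠ 0 := hl
    have R := resonant_contin hσ ha hC hZ
    refine ⟨fun h => ?_, ?_⟩
    · have h1 := hpos a l ha hl hlE hC hZ
      rw [(hE _).1 h, CharTwo.add_self_eq_zero] at h1
      exact mul_ne_zero hl (pow_ne_zero 2 R.map_x_ne) h1.symm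
    · simp only
      rw [mul_inv, trSum_mul_fixed σ _ (by rw [map_inv₀, hlE]), R.tr_inv_g]
      exact mul_ne_zero (inv_ne_zero hl) (inv_ne_zero R.N_ne)
  · rintro ⟨a, l⟩ ⟨b, k⟩ ⟨⟨ha, hZa, hCa⟩, hlE, hl⟩ ⟨⟨hb, hZb, hCb⟩, hkE, hk⟩ h
    simp only at h hZa hZb hCa hCb ha hb
    replace hlE : σ l = l := (hE l).1 hlE
    replace hkE : σ k = k := (hE k).1 hkE
    replace hl : l ≠ 0 := hl
    replace hk : k ≠ 0 := hk
    have h1 := hpos a l ha hl hlE hCa hZa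
    rw [h, hpos b k hb hk hkE hCb hZb] at h1
    set x := contin σ a (m + 2) with hx
    set y := contin σ b (m + 2) with hy
    have hsx : σ x ≠ 0 := (map_ne_zero σ).2 hCa
    have hsy : σ y ≠ 0 := (map_ne_zero σ).2 hCb
    have hsq : σ ((x / y) ^ 2) = k / l := by
      rw [map_pow, map_div₀]; field_simp; linear_combination - h1
    have hν : σ (x / y) = x / y := by
      apply σ.injective
      apply fixed_of_sq_fixed
      rw [← map_pow, hsq, map_div₀, hlE, hkE]
    obtain ⟨ν, hνdef⟩ : ∃ ν, ν = x / y := ⟨_, rfl⟩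
    rw [← hνdef] at hν hsq
    rw [map_pow, hν] at hsq
    have hxy : x = ν * y := by rw [hνdef]; field_simp
    have hab : a = b := by
      have hk' : k = l * ν ^ 2 := by rw [hsq]; field_simp
      have hν0 : ν ≠ 0 := by rintro rfl; rw [zero_mul] at hxy; exact hCa hxy
      rw [hk', hxy, map_mul, hν] at h
      have : l * ν ^ 2 * y * σ y ≠ 0 := by positivity
      apply mul_left_cancel₀ this
      linear_combination h
    have hxy' : x = y := by rw [hx, hy, hab]
    have hlk : l = k := by
      rw [← hxy'] at h1
      exact (mul_right_cancel₀ (pow_ne_zero 2 hsx) h1).symm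
    rw [hab, hlk]
  · rintro g ⟨hgE, hgT⟩
    have hgs : σ g + g ≠ 0 := fun h => hgE ((hE g).2 (CharTwo.add_eq_zero.1 h))
    have hg0 : g ≠ 0 := by rintro rfl; exact hgE E.zero_mem
    -- Reading `linPart_eq_zero_iff` backwards: σ(x) must be the square root of σg + g, and then a =
    -- g/(xσ(x)).
    obtain ⟨z, hz⟩ := (Finite.injective_iff_surjective.1 (frobenius_inj K 2)) (σ g + g)
    obtain ⟨x, rfl⟩ := (Finite.injective_iff_surjective.1 σ.injective) z
    rw [frobenius_def] at hz
    have hsx : σ x ≠ 0 := by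
      intro h; rw [h, zero_pow two_ne_zero] at hz; exact hgs hz.symm
    have hx : x ≠ 0 := (map_ne_zero σ).1 hsx
    obtain ⟨a, rfl⟩ : ∃ a, g = a * x * σ x := ⟨g / (x * σ x), by field_simp⟩
    have ha : a ≠ 0 := by rintro rfl; simp at hg0
    have hlin : linPart σ a x = 0 := (linPart_eq_zero_iff hx).2 hz.symm
    obtain ⟨ν, hν, hC, hν2⟩ := contin_eq_fixed_mul hσ ha hx hlin
    have hν0 : ν ≠ 0 := by
      rintro rfl
      rw [zero_pow two_ne_zero] at hν2
      exact mul_ne_zero (normProd_ne_zero σ _ ha) hgT hν2.symm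
    -- As C_n(a) = νx, the canonical aC_nσ(C_n) is ν² times the given element; the scalar undoes
    -- this.
    refine ⟨(a, (ν ^ 2)⁻¹), ⟨⟨ha, polyZ_contin_eq_zero hσ ha hx hlin, ?_⟩, ?_, ?_⟩, ?_⟩
    · rw [hC]; exact mul_ne_zero hν0 hx
    · exact (hE _).2 (by rw [map_inv₀, map_pow, hν])
    · exact inv_ne_zero (pow_ne_zero 2 hν0)
    · simp only [hC, map_mul, hν]
      field_simp

theorem ncard_trSum_inv_ne (σ : K →+* K) (E : Subfield K) (n : ℕ) :
    {y | y ∉ E ∧ trSum σ n y⁻¹ ≠ 0}.ncard = ({y | trSum σ n y ≠ 0} \ (E : Set K)).ncard := by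
  refine Set.ncard_congr (fun y _ => y⁻¹) ?_ (fun _ _ _ _ h => inv_injective h) ?_
  · rintro y ⟨h1, h2⟩
    exact ⟨h2, fun h => h1 (by simpa using E.inv_mem h)⟩
  · rintro y ⟨h1, h2⟩
    exact ⟨y⁻¹, ⟨fun h => h2 (by simpa using E.inv_mem h), by simpa using h1⟩, inv_inv y⟩

theorem ncard_trSum_ne_diff_of_odd {n : ℕ} (hE : ∀ y, y ∈ E ↔ σ y = y) (hn : Odd n) :
    ({y | trSum σ n y ≠ 0} \ (E : Set K)).ncard + ((E : Set K) \ {0}).ncard =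
      {y | trSum σ n y ≠ 0}.ncard := by
  have hsub : (E : Set K) \ {0} ⊆ {y | trSum σ n y ≠ 0} := by
    rintro y ⟨hy, hy0⟩
    change trSum σ n y ≠ 0
    rw [trSum_fixed σ n ((hE y).1 hy), CharTwo.natCast_eq_ite, if_neg (Nat.not_even_iff_odd.2 hn), one_mul]
    exact hy0
  rw [← Set.ncard_sdiff_add_ncard_of_subset hsub (Set.toFinite _)]
  congr 2
  ext y
  have : trSum σ n y ≠ 0 → y ≠ 0 := by rintro h rfl; simp [trSum] at h
  simp only [Set.mem_sdiff, Set.mem_ofPred_eq, Set.mem_singleton_iff]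
  tauto

theorem trSum_ne_diff_of_even {n : ℕ} (hE : ∀ y, y ∈ E ↔ σ y = y) (hn : Even n) :
    {y | trSum σ n y ≠ 0} \ (E : Set K) = {y | trSum σ n y ≠ 0} := by
  ext y
  simp only [Set.mem_sdiff, Set.mem_ofPred_eq, and_iff_left_iff_imp]
  intro h hy
  rw [trSum_fixed σ n ((hE y).1 hy), CharTwo.natCast_eq_ite, if_pos hn, zero_mul] at h
  exact h rfl

end Count

open Polynomial

/-! ### Frobenius powers, the fixed field, and Hilbert 90 by counting. -/

section Frobenius

variable {K : Type*} [Field K]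

theorem ncard_eval_eq_zero_le {p : K[X]} (hp : p ≠ 0) :
    {y | p.eval y = 0}.ncard ≤ p.natDegree := by
  classical
  have : {y | p.eval y = 0} = (p.roots.toFinset : Set K) := by
    ext y; simp [hp]
  rw [this, Set.ncard_coe_finset]
  exact (Multiset.toFinset_card_le _).trans (card_roots' p)

theorem ncard_trace_polynomial_zeros_le (K : Type*) [Field K] {d : ℕ} (hd : 0 < d) (n : ℕ) :
    {y : K | ∑ i ∈ Finset.range (n + 1), y ^ 2 ^ (i * d) = 0}.ncard ≤ 2 ^ (n * d) := by
  set p : K[X] := ∑ i ∈ Finset.range (n + 1), X ^ 2 ^ (i * d) with hp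
  have hp0 : p ≠ 0 := by
    intro h
    have h1 : p.coeff 1 = 1 := by
      rw [hp, finsetSum_coeff, Finset.sum_eq_single 0]
      · simp
      · intro i _ hi
        rw [coeff_X_pow, if_neg]
        have : 1 < 2 ^ (i * d) := Nat.one_lt_two_pow (by positivity)
        exact this.ne
      · simp
    rw [h, coeff_zero] at h1
    exact zero_ne_one h1
  have hdeg : p.natDegree ≤ 2 ^ (n * d) := by
    refine natDegree_sum_le_of_forall_le _ _ fun i hi => ?_
    rw [natDegree_X_pow]
    exact Nat.pow_le_pow_right two_pos
      (Nat.mul_le_mul_right d (Nat.lt_succ_iff.1 (Finset.mem_range.1 hi)))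
  refine le_trans (le_of_eq ?_) ((ncard_eval_eq_zero_le hp0).trans hdeg)
  simp [hp, eval_finsetSum]

variable [CharP K 2]

theorem frobenius_pow_apply (i : ℕ) (y : K) : ((frobenius K 2) ^ i) y = y ^ 2 ^ i := by
  induction i with
  | zero => simp
  | succ i ih => rw [ringHom_pow_succ_apply, ih, frobenius_def, ← pow_mul, pow_succ]

theorem tr_eq_trSum_frobenius_pow {d n : ℕ} (hd : 0 < d) (y : K) :
    tr d (n * d) y = trSum (frobenius K 2 ^ d) n y := by
  rw [tr, trSum, Nat.mul_div_cancel n hd]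
  refine Finset.sum_congr rfl fun i _ => ?_
  rw [← pow_mul, frobenius_pow_apply, mul_comm i d]

/-- The trace does not depend on the choice of the generator of the Galois group. -/
theorem trSum_pow_eq_of_coprime {σ : K →+* K} {n r : ℕ} (hn : 0 < n) (hσ : ∀ y, (σ ^ n) y = y)
    (h : Nat.Coprime r n) (y : K) : trSum (σ ^ r) n y = trSum σ n y := by
  have hmod : ∀ j, (σ ^ (j % n)) y = (σ ^ j) y := by
    intro j
    conv_rhs => rw [← Nat.mod_add_div j n, pow_add, pow_mul, RingHom.mul_def, RingHom.comp_apply,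
      ringHom_pow_fixed (σ ^ n) _ (hσ y)]
  have hinj : Set.InjOn (fun i => i * r % n) (Finset.range n : Set ℕ) := by
    intro i hi j hj hij
    have h1 : i ≡ j [MOD n] := Nat.ModEq.cancel_right_of_coprime h.symm hij
    have hi' := Finset.mem_range.1 hi
    have hj' := Finset.mem_range.1 hj
    exact Nat.ModEq.eq_of_lt_of_lt h1 hi' hj'
  have hmaps : Set.MapsTo (fun i => i * r % n) (Finset.range n : Set ℕ) (Finset.range n) :=
    fun i _ => Finset.mem_coe.2 (Finset.mem_range.2 (Nat.mod_lt _ hn))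
  refine Finset.sum_nbij (fun i => i * r % n) hmaps hinj
    (Finset.surjOn_of_injOn_of_card_le _ hmaps hinj le_rfl) fun i _ => ?_
  rw [hmod, ← pow_mul, mul_comm i r]

variable [Fintype K] {E : Subfield K} {d k l n r : ℕ}

theorem mem_iff_frobenius_pow_fixed (hK : Fintype.card K = 2 ^ k) [Fintype E]
    (hE : Fintype.card E = 2 ^ d) (hd : d = Nat.gcd l k) (hd0 : 0 < d) (y : K) :
    y ∈ E ↔ (frobenius K 2 ^ l) y = y := by
  have hq : 1 < 2 ^ d := Nat.one_lt_two_pow hd0.ne'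
  have hEq : ∀ z ∈ E, z ^ 2 ^ d = z := by
    intro z hz
    have := FiniteField.pow_card (⟨z, hz⟩ : E)
    rw [hE] at this
    exact congrArg Subtype.val this
  -- E already supplies 2^d roots, the maximum possible. An element fixed by Frobenius^l is also
  -- fixed by Frobenius^k, hence by Frobenius^gcd, and so is such a root.
  have hset : (E : Set K) = {z | (X ^ 2 ^ d - X : K[X]).eval z = 0} := by
    refine Set.eq_of_subset_of_ncard_le ?_ ?_ (Set.toFinite _)
    · intro z hz
      simp only [Set.mem_ofPred_eq, eval_sub, eval_pow, eval_X, sub_eq_zero]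
      exact hEq z hz
    · refine (ncard_eval_eq_zero_le (FiniteField.X_pow_card_sub_X_ne_zero K hq)).trans ?_
      rw [FiniteField.X_pow_card_sub_X_natDegree_eq K hq]
      have : (E : Set K).ncard = Fintype.card E := by
        rw [← Nat.card_coe_set_eq]; exact Nat.card_eq_fintype_card
      rw [this, hE]
  constructor
  · intro hy
    have hdl : d ∣ l := hd ▸ Nat.gcd_dvd_left l k
    obtain ⟨r, rfl⟩ := hdl
    rw [pow_mul]
    exact ringHom_pow_fixed _ _ (by rw [frobenius_pow_apply]; exact hEq y hy)
  · intro hy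
    have h1 : Function.IsPeriodicPt (frobenius K 2) l y := by
      rw [RingHom.coe_pow] at hy; exact hy
    have h2 : Function.IsPeriodicPt (frobenius K 2) k y := by
      have : (frobenius K 2 ^ k) y = y := by
        rw [frobenius_pow_apply, ← hK, FiniteField.pow_card]
      exact this
    have h3 : (frobenius K 2 ^ d) y = y := by
      rw [hd]; exact h1.gcd h2
    rw [frobenius_pow_apply] at h3
    have : y ∈ (E : Set K) := by
      rw [hset]
      simp [h3]
    exact this

/-- The trace-zero elements are exactly those of the form `σ t + t`; their number. -/
theorem ncard_trSum_eq_zero {σ : K →+* K} (hσ : ∀ y, (σ ^ n) y = y)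
    (hE : ∀ y, y ∈ E ↔ σ y = y) (hn : 0 < n)
    (hcE : Nat.card E = 2 ^ d) (hcK : Nat.card K = 2 ^ (n * d))
    (hT : {y : K | trSum σ n y = 0}.ncard ≤ 2 ^ ((n - 1) * d)) :
    {y : K | trSum σ n y = 0}.ncard = 2 ^ ((n - 1) * d) ∧
      ∀ y, trSum σ n y = 0 → ∃ t, σ t + t = y := by
  let τ : K →+ K := (σ : K →+ K) + AddMonoidHom.id K
  have hτ : ∀ y, τ y = σ y + y := fun y => rfl
  have hker : Nat.card τ.ker = 2 ^ d := by
    rw [← hcE]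
    refine Nat.card_congr (Equiv.subtypeEquivRight fun y => ?_)
    rw [AddMonoidHom.mem_ker, hτ, hE, CharTwo.add_eq_zero]
  have hrange : Nat.card τ.range = 2 ^ ((n - 1) * d) := by
    -- The image of σ + 1 lies in the trace kernel and has size |K|/|E|, which meets the bound `hT`;
    -- hence the two coincide.
    have h := AddSubgroup.card_eq_card_quotient_mul_card_addSubgroup τ.ker
    rw [Nat.card_congr (QuotientAddGroup.quotientKerEquivRange τ).toEquiv, hker, hcK] at h
    obtain ⟨m, rfl⟩ : ∃ m, n = m + 1 := ⟨n - 1, by omega⟩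
    rw [add_mul, one_mul, pow_add] at h
    exact (Nat.eq_of_mul_eq_mul_right (by positivity) h).symm
  have hsub : (τ.range : Set K) ⊆ {y | trSum σ n y = 0} := by
    rintro _ ⟨t, rfl⟩
    change trSum σ n (σ t + t) = 0
    rw [trSum_add, trSum_map hσ, CharTwo.add_self_eq_zero]
  have hr : (τ.range : Set K).ncard = 2 ^ ((n - 1) * d) := hrange
  have heq := Set.eq_of_subset_of_ncard_le hsub (hr ▸ hT) (Set.toFinite _)
  refine ⟨heq ▸ hr, fun y hy => ?_⟩
  have : y ∈ (τ.range : Set K) := by rw [heq]; exact hy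
  exact this

end Frobenius

/-! ### From polynomials to continuants. -/

section Evaluation

variable {K : Type*} [Field K] [CharP K 2] (l : ℕ) (a : K)

theorem polyC_eval : ∀ i, (polyC K l i).eval a = contin (frobenius K 2 ^ l) a i
  | 0 => by simp [polyC, contin]
  | 1 => by simp [polyC, contin]
  | 2 => by simp [polyC, contin]
  | (i + 3) => by
    rw [polyC, contin_add_two, ← polyC_eval (i + 2), ← polyC_eval (i + 1), ← pow_mul,
      frobenius_pow_apply, mul_comm l]
    simp

theorem polyZ_eval (m : ℕ) : (polyZ K l (m + 2)).eval a =
    contin (frobenius K 2 ^ l) a (m + 3) +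
      a * (frobenius K 2 ^ l) (contin (frobenius K 2 ^ l) a (m + 1)) := by
  rw [polyZ, if_neg (by omega), frobenius_pow_apply, ← polyC_eval, ← polyC_eval]
  simp

theorem zerosF_eq (c : K) :
    zerosF l c a = {v | linPart (frobenius K 2 ^ l) a v + c = 0} := by
  ext v
  simp only [zerosF, polyF, linPart, frobenius_pow_apply, Set.mem_ofPred_eq, ← pow_mul, ← pow_add]
  simp [two_mul]

theorem explicitZero_eq {m h : ℕ} (hm : m + 1 = 2 * h) (ha : a ≠ 0) (c μ : K)
    (hx : contin (frobenius K 2 ^ l) a (m + 2) ≠ 0) :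
    explicitZero l (m + 2) c a μ = contin (frobenius K 2 ^ l) a (m + 2) *
      (c * ∑ i ∈ Finset.range (h + 1), ((frobenius K 2 ^ l) ^ (2 * i))
        (a * (frobenius K 2 ^ l) (contin (frobenius K 2 ^ l) a (m + 1)) *
          (a * contin (frobenius K 2 ^ l) a (m + 2) *
            (frobenius K 2 ^ l) (contin (frobenius K 2 ^ l) a (m + 2)))⁻¹)) +
      μ * contin (frobenius K 2 ^ l) a (m + 2) := by
  have h1 : (m + 2 - 1) / 2 + 1 = h + 1 := by omega
  rw [explicitZero, h1, polyC_eval, polyC_eval, show m + 2 - 1 = m + 1 by omega]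
  congr 1
  rw [mul_left_comm]
  congr 1
  rw [Finset.mul_sum]
  refine Finset.sum_congr rfl fun i _ => ?_
  generalize contin (frobenius K 2 ^ l) a (m + 2) = x at *
  generalize contin (frobenius K 2 ^ l) a (m + 1) = y at *
  have hσx : (frobenius K 2 ^ l) x ≠ 0 := (_root_.map_ne_zero _).2 hx
  have h2 : a * (frobenius K 2 ^ l) y * (a * x * (frobenius K 2 ^ l) x)⁻¹ =
      (frobenius K 2 ^ l) y / (x * (frobenius K 2 ^ l) x) := by field_simp
  have h3 : ∀ z : K, ((frobenius K 2 ^ l) ^ (2 * i)) z = z ^ 2 ^ (2 * i * l) := by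
    intro z; rw [← pow_mul, frobenius_pow_apply, mul_comm l]
  have h4 : ∀ z : K, ((frobenius K 2 ^ l) ^ (2 * i)) ((frobenius K 2 ^ l) z) =
      z ^ 2 ^ ((2 * i + 1) * l) := by
    intro z
    rw [h3, frobenius_pow_apply, ← pow_mul, ← pow_add]
    ring_nf
  rw [h2, map_div₀, map_mul, h4, h4, h3]
  -- The `- 1` in the exponent is the outer factor C_n(a) absorbed into each summand.
  have h5 : x ^ (2 ^ ((2 * i + 1) * l) + 2 ^ (2 * i * l) - 1) * x =
      x ^ 2 ^ (2 * i * l) * x ^ 2 ^ ((2 * i + 1) * l) := by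
    rw [← pow_succ, ← pow_add]
    congr 1
    rw [Nat.sub_add_cancel (le_add_left Nat.one_le_two_pow), add_comm]
  rw [← h5]
  field_simp

end Evaluation

/-! ### The absolute trace and sign sums. -/

section AbsoluteTrace

variable {K : Type*} [Field K] [CharP K 2]

theorem frobenius_pow_eq_self [Fintype K] {k : ℕ} (hK : Fintype.card K = 2 ^ k) (y : K) :
    (frobenius K 2 ^ k) y = y := by
  rw [frobenius_pow_apply, ← hK, FiniteField.pow_card]

theorem tr_one_eq (k : ℕ) (y : K) : tr 1 k y = trSum (frobenius K 2) k y := by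
  have := tr_eq_trSum_frobenius_pow (n := k) one_pos y
  rwa [mul_one, pow_one] at this

theorem trSum_add_sq {k : ℕ} (hk : ∀ y : K, (frobenius K 2 ^ k) y = y) (w : K) :
    trSum (frobenius K 2) k (w + w ^ 2) = 0 := by
  rw [trSum_add, ← frobenius_def 2 w, trSum_map hk, CharTwo.add_self_eq_zero]

theorem trSum_eq_zero_or_one {k : ℕ} (hk : ∀ y : K, (frobenius K 2 ^ k) y = y) (y : K) :
    trSum (frobenius K 2) k y = 0 ∨ trSum (frobenius K 2) k y = 1 := by
  have h := map_trSum hk y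
  rw [frobenius_def] at h
  rcases eq_or_ne (trSum (frobenius K 2) k y) 0 with h0 | h0
  · exact Or.inl h0
  · refine Or.inr (mul_left_cancel₀ h0 ?_)
    rw [mul_one, ← sq, h]

/-- The trace of an element of a subfield over which the degree is `n`. -/
theorem trSum_mul_range (φ : K →+* K) {d : ℕ} {e : K} (he : (φ ^ d) e = e) (n : ℕ) :
    trSum φ (n * d) e = n * trSum φ d e := by
  induction n with
  | zero => simp [trSum]
  | succ n ih =>
    rw [add_mul, one_mul, trSum, Finset.sum_range_add, ← trSum, ih]
    have : ∀ x, (φ ^ (n * d + x)) e = (φ ^ x) e := by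
      intro x
      rw [add_comm, pow_add, mul_comm n d, pow_mul, RingHom.mul_def, RingHom.comp_apply,
        ringHom_pow_fixed _ _ he]
    simp only [this]
    change n * trSum φ d e + trSum φ d e = _
    push_cast
    ring

/-- The trace polynomial has degree 2^(d-1), too small to vanish on all 2^d elements of E. -/
theorem exists_trSum_ne_zero [Finite K] {E : Subfield K} {d : ℕ} (hd : 0 < d)
    (hE : Nat.card E = 2 ^ d) : ∃ e ∈ E, trSum (frobenius K 2) d e ≠ 0 := by
  by_contra! h
  have hle := ncard_trace_polynomial_zeros_le K one_pos (d - 1)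
  have hsub : (E : Set K) ⊆
      {y : K | ∑ i ∈ Finset.range (d - 1 + 1), y ^ 2 ^ (i * 1) = 0} := by
    intro y hy
    have := h y hy
    simpa [trSum, frobenius_pow_apply, Nat.sub_add_cancel hd, -RingHom.coe_pow] using this
  have h1 := (Set.ncard_le_ncard hsub (Set.toFinite _)).trans hle
  have h2 : (E : Set K).ncard = 2 ^ d := hE
  rw [h2, mul_one] at h1
  have := (Nat.pow_le_pow_iff_right one_lt_two).1 h1
  omega

theorem sum_sign_eq_zero {E : Type*} [AddCommGroup E] [Fintype E] (f : E → K) (μ₀ : E)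
    (h01 : ∀ μ, f μ = 0 ∨ f μ = 1) (hf : ∀ μ, f (μ + μ₀) = f μ + 1) :
    ∑ μ, sign (f μ) = 0 := by
  have h := Equiv.sum_comp (Equiv.addRight μ₀) (fun μ => sign (f μ))
  have h' : ∀ μ, sign (f (Equiv.addRight μ₀ μ)) = - sign (f μ) := by
    intro μ
    rw [Equiv.coe_addRight, hf]
    rcases h01 μ with h0 | h0 <;> simp [h0, sign, CharTwo.add_self_eq_zero]
  simp only [h', Finset.sum_neg_distrib] at h
  omega

end AbsoluteTrace

/-! ### Explicit solution for odd n, and trace values along the zeros. -/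

section Zeros

variable {K : Type*} [Field K] [CharP K 2] {σ : K →+* K} {m : ℕ} {a x u g N : K}

/-- Applying σ + 1 to the even conjugates gives the first 2h + 2 = n + 1 conjugates: a full trace,
which is zero, plus one more term that wraps around to u/g. -/
theorem Resonant.explicit_solution {h : ℕ} (R : Resonant σ (2 * h + 1) a x u g N) {c : K}
    (hc : σ c = c) :
    σ (c * ∑ i ∈ Finset.range (h + 1), (σ ^ (2 * i)) (u * g⁻¹)) +
      c * ∑ i ∈ Finset.range (h + 1), (σ ^ (2 * i)) (u * g⁻¹) = c * (u * g⁻¹) := by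
  have key : ∀ j, σ (∑ i ∈ Finset.range j, (σ ^ (2 * i)) (u * g⁻¹)) +
      ∑ i ∈ Finset.range j, (σ ^ (2 * i)) (u * g⁻¹) = trSum σ (2 * j) (u * g⁻¹) := by
    intro j
    induction j with
    | zero => simp [trSum]
    | succ j ih =>
      rw [Finset.sum_range_succ, map_add, trSum, mul_add, Finset.sum_range_succ,
        Finset.sum_range_succ, ← trSum, ← ih, ringHom_pow_succ_apply]
      ring
  rw [map_mul, hc, ← mul_add, key, trSum, mul_add, mul_one, Finset.sum_range_succ, ← trSum,
    R.tr_u_div, R.iter, zero_add]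

/-- The values of the absolute trace form along the zeros. -/
theorem Resonant.trSum_quad {n k : ℕ} (R : Resonant σ n a x u g N)
    (hk : ∀ y : K, (frobenius K 2 ^ k) y = y) {c t μ : K} (hc : c ≠ 0)
    (ht : σ t + t = c * (u * g⁻¹)) (hμ : σ μ = μ) :
    trSum (frobenius K 2) k (a * (c ^ 2)⁻¹ * ((x * t + μ * x) * σ (x * t + μ * x))) =
      trSum (frobenius K 2) k (a * (c ^ 2)⁻¹ * (x * t * σ (x * t))) +
        trSum (frobenius K 2) k ((μ * c⁻¹) ^ 2 * N) := by
  rw [R.quad_shift hc ht hμ, trSum_add, trSum_add, trSum_add_sq hk, add_zero]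

end Zeros

end AffinePoly

/-! ### Assembly of the theorem. -/

theorem mainTheorem10 (k l d n : ℕ) (hl : 0 < l) (hlk : l < k) (hd : d = Nat.gcd l k)
    (hn : k = n * d)
    {K : Type*} [Field K] [Fintype K] (hK : Fintype.card K = 2 ^ k)
    (E : Subfield K) [Fintype E] (hE : Fintype.card E = 2 ^ d)
    (c : K) (hc : c ∈ E) :
    (∀ a : K, a ≠ 0 →
      ((AffinePoly.zerosF l c a).ncard = 2 ^ d ↔
        (AffinePoly.polyZ K l n).eval a = 0 ∧ (AffinePoly.polyC K l n).eval a ≠ 0) ∧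
      ((AffinePoly.zerosF l c a).ncard = 2 ^ d →
        (∀ v ∈ AffinePoly.zerosF l c a, AffinePoly.tr d k v = ((n - 1 : ℕ) : K) * c) ∧
        (Even n → c ≠ 0 →
          ∀ v ∈ AffinePoly.zerosF l c a, ∀ w ∈ AffinePoly.zerosF l c a,
            AffinePoly.tr 1 k (a * (c ^ 2)⁻¹ * v ^ (2 ^ l + 1)) =
              AffinePoly.tr 1 k (a * (c ^ 2)⁻¹ * w ^ (2 ^ l + 1))) ∧
        (Odd n →
          AffinePoly.zerosF l c a =
            Set.range (fun μ : E => AffinePoly.explicitZero l n c a (μ : K)) ∧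
          (c ≠ 0 →
            ∑ μ : E, AffinePoly.sign (AffinePoly.tr 1 k
              (a * (c ^ 2)⁻¹ * AffinePoly.explicitZero l n c a (μ : K) ^ (2 ^ l + 1))) = 0)))) ∧
    (Odd n → (AffinePoly.setN l c (2 ^ d) : Set K).ncard = 2 ^ (k - d) - 1) ∧
    (Even n → (AffinePoly.setN l c (2 ^ d) : Set K).ncard = 2 ^ (k - d)) := by
  open AffinePoly in
  have hd0 : 0 < d := hd ▸ Nat.gcd_pos_of_pos_left k hl
  obtain ⟨m, rfl⟩ : ∃ m, n = m + 2 := by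
    refine ⟨n - 2, ?_⟩
    have : d ≤ l := hd ▸ Nat.gcd_le_left k hl
    rcases n with _ | _ | n <;> omega
  obtain ⟨r, hr⟩ : d ∣ l := hd ▸ Nat.gcd_dvd_left l k
  have hcop : Nat.Coprime r (m + 2) := by
    rw [hr, hn, mul_comm d r, Nat.gcd_mul_right] at hd
    exact Nat.eq_of_mul_eq_mul_right hd0 (by rw [one_mul]; exact hd.symm)
  have : CharP K 2 := charP_of_card_eq_prime_pow hK
  have hk : ∀ y : K, (frobenius K 2 ^ k) y = y := frobenius_pow_eq_self hK
  set σ : K →+* K := frobenius K 2 ^ l with hσdef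
  have hφ : ∀ y : K, ((frobenius K 2 ^ d) ^ (m + 2)) y = y := by
    intro y; rw [← pow_mul, mul_comm, ← hn]; exact hk y
  have hσ : ∀ y : K, (σ ^ (m + 2)) y = y := by
    intro y
    have : σ ^ (m + 2) = (frobenius K 2 ^ k) ^ r := by
      rw [hσdef, ← pow_mul, ← pow_mul, hr, hn]; ring_nf
    rw [this]
    exact ringHom_pow_fixed _ _ (hk y)
  have hEσ : ∀ y, y ∈ E ↔ σ y = y := mem_iff_frobenius_pow_fixed hK hE hd hd0
  have hEd : ∀ y ∈ E, (frobenius K 2 ^ d) y = y := by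
    intro y hy
    rw [frobenius_pow_apply, ← hE]
    exact congrArg Subtype.val (FiniteField.pow_card (⟨y, hy⟩ : E))
  have htr : ∀ y : K, tr d k y = trSum σ (m + 2) y := by
    intro y
    rw [hn, tr_eq_trSum_frobenius_pow hd0, hσdef, hr, pow_mul,
      trSum_pow_eq_of_coprime (by omega) hφ hcop]
  have hcE : Nat.card E = 2 ^ d := by rw [Nat.card_eq_fintype_card, hE]
  have hcK : Nat.card K = 2 ^ ((m + 2) * d) := by rw [Nat.card_eq_fintype_card, hK, hn]
  have hkd : k - d = (m + 1) * d := by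
    rw [hn, show (m + 2) * d = (m + 1) * d + d by ring]; omega
  obtain ⟨hT0, h90⟩ := ncard_trSum_eq_zero (d := d) hσ hEσ (by omega) hcE hcK (by
    -- The degree bound is taken for the generator Frobenius^d, whose trace polynomial has the right
    -- degree; `htr` identifies that trace with the one for σ.
    refine le_trans (le_of_eq ?_) (ncard_trace_polynomial_zeros_le K hd0 (m + 1))
    congr 1
    ext y
    simp only [Set.mem_ofPred_eq]
    rw [← htr, hn, tr, Nat.mul_div_cancel _ hd0])
  have hcσ : σ c = c := (hEσ c).1 hc
  have hiff : ∀ a : K, a ≠ 0 → ((zerosF l c a).ncard = 2 ^ d ↔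
      contin σ a (m + 3) + a * σ (contin σ a (m + 1)) = 0 ∧ contin σ a (m + 2) ≠ 0) := by
    intro a ha
    rw [zerosF_eq, ← hcE]
    refine ⟨resonance_of_ncard_zeros hσ hEσ h90 ha, fun ⟨hZ, hC⟩ => ?_⟩
    have R := resonant_contin hσ ha hC hZ
    obtain ⟨t, ht⟩ := h90 (c * (_ * _⁻¹)) (by rw [trSum_mul_fixed σ _ hcσ, R.tr_u_div, mul_zero])
    rw [← hσdef, R.zeros_eq_range hEσ hcσ ht, ncard_range_add_mul E R.x_ne]
  have hpow : ∀ v : K, v ^ (2 ^ l + 1) = v * σ v := by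
    intro v; rw [hσdef, frobenius_pow_apply, pow_succ, mul_comm]
  refine ⟨fun a ha => ⟨?_, fun hcard => ?_⟩, ?_⟩
  · rw [hiff a ha, polyZ_eval, polyC_eval]
  · obtain ⟨hZ, hC⟩ := (hiff a ha).1 hcard
    have R := resonant_contin hσ ha hC hZ
    obtain ⟨t, ht⟩ := h90 (c * (_ * _⁻¹)) (by rw [trSum_mul_fixed σ _ hcσ, R.tr_u_div, mul_zero])
    have hzeros := R.zeros_eq_range hEσ hcσ ht
    have hNE := R.map_N
    rw [zerosF_eq, ← hσdef]
    refine ⟨?_, ?_, ?_⟩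
    · intro v hv
      have hv' : v = contin σ a (m + 2) * (v / contin σ a (m + 2)) := by field_simp
      change linPart σ a v + c = 0 at hv
      rw [hv'] at hv ⊢
      rw [htr, R.tr_zero hcσ ((R.linPart_mul_add_eq_zero_iff hcσ _).1 hv)]
      have h2 : (2 : K) = 0 := CharTwo.two_eq_zero
      -- The factors n + 1 and n - 1 agree in characteristic 2.
      rw [show m + 2 - 1 = m + 1 by omega]
      push_cast
      linear_combination c * h2
    · intro hev hc0
      have hval : ∀ v ∈ {v | linPart σ a v + c = 0},
          tr 1 k (a * (c ^ 2)⁻¹ * v ^ (2 ^ l + 1)) =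
            trSum (frobenius K 2) k (a * (c ^ 2)⁻¹ *
              (contin σ a (m + 2) * t * σ (contin σ a (m + 2) * t))) := by
        intro v hv
        rw [hzeros] at hv
        obtain ⟨μ, rfl⟩ := hv
        have hμ := (hEσ _).1 μ.2
        rw [hpow, tr_one_eq]
        rw [R.trSum_quad hk hc0 ht hμ]
        have hfix : ((μ : K) * c⁻¹) ^ 2 * normProd σ (m + 2) a ∈ E := by
          rw [hEσ, map_mul, map_pow, map_mul, map_inv₀, hμ, hcσ, hNE]
        rw [hn, trSum_mul_range _ (hEd _ hfix), CharTwo.natCast_eq_ite, if_pos hev, zero_mul,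
          add_zero]
      intro v hv w hw
      rw [hval v hv, hval w hw]
    · intro hodd
      obtain ⟨h, hh⟩ : ∃ h, m + 1 = 2 * h := by
        obtain ⟨h, hh⟩ := hodd; exact ⟨h, by omega⟩
      have hm : m + 2 = 2 * h + 1 := by omega
      have R' := R
      rw [show Resonant σ (m + 2) = Resonant σ (2 * h + 1) by rw [hm]] at R'
      have ht := R'.explicit_solution hcσ
      have hex : ∀ μ : K, explicitZero l (m + 2) c a μ = _ :=
        fun μ => explicitZero_eq l a hh ha c μ hC
      simp only [← hσdef] at hex
      simp only [hex]
      refine ⟨R.zeros_eq_range hEσ hcσ ht, fun hc0 => ?_⟩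
      obtain ⟨e, heE, he⟩ := exists_trSum_ne_zero hd0 hcE
      have hN0 := R.N_ne
      -- `s` is chosen so that (s/c)²N = e. Since n is odd, e has absolute trace 1, so translating μ
      -- by `s` flips every sign.
      obtain ⟨s, hs⟩ := (Finite.injective_iff_surjective.1 (frobenius_inj K 2))
        (e * c ^ 2 * (normProd σ (m + 2) a)⁻¹)
      rw [frobenius_def] at hs
      have hsσ : σ s = s := by
        apply fixed_of_sq_fixed
        rw [hs, map_mul, map_mul, map_pow, map_inv₀, hNE, hcσ, (hEσ e).1 heE]
      have hse : (s * c⁻¹) ^ 2 * normProd σ (m + 2) a = e := by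
        rw [mul_pow, hs]; field_simp
      have he1 : trSum (frobenius K 2) k ((s * c⁻¹) ^ 2 * normProd σ (m + 2) a) = 1 := by
        refine (trSum_eq_zero_or_one hk _).resolve_left ?_
        rw [hse, hn, trSum_mul_range _ (hEd _ heE), CharTwo.natCast_eq_ite,
          if_neg (Nat.not_even_iff_odd.2 hodd), one_mul]
        exact he
      refine sum_sign_eq_zero _ (⟨s, (hEσ s).2 hsσ⟩ : E) (fun μ => ?_) fun μ => ?_
      · rw [tr_one_eq]; exact trSum_eq_zero_or_one hk _
      · have hμ := (hEσ _).1 μ.2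
        have hμs : σ ((μ + ⟨s, (hEσ s).2 hsσ⟩ : E) : K) = ((μ + ⟨s, (hEσ s).2 hsσ⟩ : E) : K) :=
          (hEσ _).1 (Subtype.mem _)
        have hsum : (((μ + ⟨s, (hEσ s).2 hsσ⟩ : E) : K) * c⁻¹) ^ 2 * normProd σ (m + 2) a =
            ((μ : K) * c⁻¹) ^ 2 * normProd σ (m + 2) a +
              (s * c⁻¹) ^ 2 * normProd σ (m + 2) a := by
          rw [show ((μ + ⟨s, (hEσ s).2 hsσ⟩ : E) : K) = μ + s from rfl, add_mul, add_pow_char,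
            add_mul]
        rw [tr_one_eq, tr_one_eq, hpow, hpow, R.trSum_quad hk hc0 ht hμs, R.trSum_quad hk hc0 ht hμ,
          hsum, trSum_add _ _ (((μ : K) * c⁻¹) ^ 2 * _), he1, add_assoc]
  · have hS : setN l c (2 ^ d) = {a : K | a ≠ 0 ∧
        contin σ a (m + 3) + a * σ (contin σ a (m + 1)) = 0 ∧ contin σ a (m + 2) ≠ 0} := by
      ext a
      simp only [setN, Set.mem_ofPred_eq]
      exact and_congr_right fun ha => hiff a ha
    have hmul := ncard_resonance_mul hσ hEσ
    rw [← hS, ncard_trSum_inv_ne] at hmul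
    have hE0 : ((E : Set K) \ {0}).ncard + 1 = 2 ^ d := by
      rw [← hcE]
      exact Set.ncard_sdiff_singleton_add_one E.zero_mem (Set.toFinite _)
    have hTne : {y : K | trSum σ (m + 2) y ≠ 0}.ncard + 2 ^ (k - d) = 2 ^ (k - d) * 2 ^ d := by
      have h := Set.ncard_add_ncard_compl {y : K | trSum σ (m + 2) y = 0}
      rw [hT0, hcK] at h
      rw [hkd, ← pow_add, add_comm, show (m + 1) * d + d = (m + 2) * d by ring]
      exact h
    have hq : 2 ≤ 2 ^ d := by
      calc 2 = 2 ^ 1 := rfl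
        _ ≤ 2 ^ d := Nat.pow_le_pow_right two_pos hd0
    have hodd_card (h : Odd (m + 2)) := ncard_trSum_ne_diff_of_odd (σ := σ) hEσ h
    have heven_card (h : Even (m + 2)) : ({y : K | trSum σ (m + 2) y ≠ 0} \ (E : Set K)).ncard =
        {y : K | trSum σ (m + 2) y ≠ 0}.ncard := by rw [trSum_ne_diff_of_even hEσ h]
    rw [← hmul] at hodd_card heven_card
    -- From here `q` is |E| - 1. The trace is nonzero on 2^(k-d)·q elements; for odd n, exactly `q`
    -- of them lie in E, for even n none.
    generalize ((E : Set K) \ {0}).ncard = q at *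
    generalize (setN l c (2 ^ d) : Set K).ncard = M at *
    generalize {y : K | trSum σ (m + 2) y ≠ 0}.ncard = A at *
    rw [← hE0] at hTne hq
    have hA : A = 2 ^ (k - d) * q := by linarith
    refine ⟨fun hodd => ?_, fun hev => ?_⟩
    · have h := (hodd_card hodd).trans hA
      have h' : (M + 1) * q = 2 ^ (k - d) * q := by linarith
      have := Nat.eq_of_mul_eq_mul_right (by omega) h'
      omega
    · exact Nat.eq_of_mul_eq_mul_right (by omega) ((heven_card hev).trans hA)
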